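/- **Theorem (GSS solution probability for $C(d)$, $d>1$).** Fix an integer $d>1$ and a constant $\epsilon>0$, let $C=C(d)=\{\pm1,\pm2,\dots,\pm d\}$, so $|C|=2d$, and let $h:\mathbb N\to\mathbb R$ be any function with $h(n)\to0$ as $n\to\infty$. Then there is a function $e:\mathbb N\to\mathbb R$ with $e(n)\to0$ as $n\to\infty$, depending only on $d$, $\epsilon$ and $h$, such that for all integers $n\ge1$, $M\ge2$ and every integer $\tau$ with $|\tau|\le h(n)\,Mn$ (that is, $|\tau|=o(Mn)$ with rate $h$), when $x$ is uniformly distributed in $\{0,1,\dots,M-1\}^n$, $$ \Pr_{x}\big[\exists\, c\in C^n:\ x\cdot c=\tau\big]\; \begin{cases} \ \ge\ 1-e(n) & \text{if } M\le |C|^{(1-\epsilon)n},\\[2pt] \ \le\ |C|^n/M & \text{if } M\ge |C|^n . \end{cases} $$ -/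

import Mathlib

/-- The coefficient set `C(d) = {±1, ±2, …, ±d}`. -/
noncomputable def coeffSet (d : ℕ) : Finset ℤ := (Finset.Icc (-(d : ℤ)) (d : ℤ)).erase 0

/-- The set `[0 : M - 1]^n` of input vectors, as a set of integer vectors. -/
def inputVectors (n M : ℕ) : Set (Fin n → ℤ) :=
  {x | ∀ i, x i ∈ Set.Icc (0 : ℤ) ((M : ℤ) - 1)}

/-- The instance `x` of Generalized Subset Sum with coefficient set `C` and target `τ` has a
solution: some `c ∈ C^n` satisfies `x · c = τ`. -/
def HasSolution {n : ℕ} (C : Finset ℤ) (τ : ℤ) (x : Fin n → ℤ) : Prop :=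
  ∃ c : Fin n → ℤ, (∀ i, c i ∈ C) ∧ x ⬝ᵥ c = τ

/-- The probability, over `x` uniformly distributed in `[0 : M - 1]^n`, that the instance `x`
with coefficient set `C` and target `τ` has a solution. -/
noncomputable def solutionProb (C : Finset ℤ) (n M : ℕ) (τ : ℤ) : ℝ :=
  (ProbabilityTheory.uniformOn (inputVectors n M)).real {x | HasSolution C τ x}

/-! The upper bound is a union bound: each `c` has no zero coordinate, so `x · c = τ` has
probability at most `1 / M`.

For the lower bound, the coordinates are split into a main block of size `n₁`, `k` pairs and `m`
greedy coordinates, with `k` and `m` small multiples of `n` such that `M ≤ |C| ^ n₁` still holds. On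
the main block, pairwise collisions are rare on average. With Markov, Chebyshev and Cauchy–Schwarz,
most `x` attain at least `M / (8w)` distinct values of size `O(√n M)`, and by pigeonhole some window
of length about `M / K` contains a set `G` of at least `M / Γ` of them, where `Γ = O(√n)` for fixed
`w`, `K` (`card_not_dense_window_le`).

The other coordinates must carry `τ` into `G`. Greedy signs bring the residual target `t` within `M
- 1` of the window's left end. In each pair, changing a coefficient `1` to `2` or `-1` to `-2`
shifts `t` by a uniform amount down or up, so for a fixed `t` within reach of the whole window each
pair hits `G` with probability at least `1 / (2Γ)`; the coefficients `±2` are where `d > 1` enters.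
Although `t` depends on the pairs, given the pairs it takes each value with probability at most `1 /
M`. Summing over about `2M` values bounds the failure by `2 (1 - 1 / (2Γ)) ^ k`, which vanishes
because `k` is linear in `n` and `Γ` is `O(√n)` (`card_not_reach_le`). -/

/-! ### Counting and second-moment tools -/

/-- A linear equation with a nonzero coefficient holds for at most a `1 / M` fraction of the
vectors with entries in `Fin M`. -/
theorem card_linear_eq_mul_le {ι : Type*} [Fintype ι] [DecidableEq ι] (M : ℕ) (c : ι → ℤ) (j : ι)
    (hj : c j ≠ 0) (t : ℤ) :
    (Finset.univ.filter fun x : ι → Fin M => ∑ i, (x i : ℤ) * c i = t).card * M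
      ≤ M ^ Fintype.card ι := by
  classical
  have key : ((Finset.univ.filter fun x : ι → Fin M => ∑ i, (x i : ℤ) * c i = t) ×ˢ
      (Finset.univ : Finset (Fin M))).card ≤ (Finset.univ : Finset (ι → Fin M)).card := by
    -- Overwriting coordinate `j` loses nothing: the equation recovers `x j` from the other
    -- coordinates.
    apply Finset.card_le_card_of_injOn (fun p => Function.update p.1 j p.2) (by simp)
    rintro ⟨x, s⟩ hx ⟨y, u⟩ hy hxy
    simp only [Finset.coe_product, Finset.coe_filter, Finset.mem_univ, true_and,
      Finset.coe_univ, Set.mem_prod, Set.mem_ofPred_eq, Set.mem_univ, and_true] at hx hy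
    have hoff : ∀ i, i ≠ j → x i = y i := fun i hi => by
      have := congrFun hxy i
      simpa [hi] using this
    have hsu : s = u := by
      have := congrFun hxy j
      simpa using this
    have h0 : ∑ i, ((x i : ℤ) * c i - (y i : ℤ) * c i) = 0 := by
      rw [Finset.sum_sub_distrib, hx, hy, sub_self]
    rw [Finset.sum_eq_single j (fun i _ hi => by rw [hoff i hi, sub_self]) (by simp)] at h0
    have h1 : ((x j : ℤ) - (y j : ℤ)) * c j = 0 := by rw [sub_mul]; exact h0
    have hxj : x j = y j := by
      rcases mul_eq_zero.1 h1 with h | h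
      · exact Fin.ext (by omega)
      · exact absurd h hj
    refine Prod.ext (funext fun i => ?_) hsu
    by_cases hi : i = j
    · subst hi; exact hxj
    · exact hoff i hi
  simpa [Finset.card_product] using key

/-- The second moment of a sum of independent centred bounded variables. -/
theorem sum_sq_sum_le {α : Type*} (A : Finset α) (B : ℝ) :
    ∀ (n : ℕ) (f : Fin n → α → ℝ), (∀ i, ∑ a ∈ A, f i a = 0) → (∀ i, ∀ a ∈ A, f i a ^ 2 ≤ B) →
      ∑ c ∈ Fintype.piFinset (fun _ : Fin n => A), (∑ i, f i (c i)) ^ 2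
        ≤ n * B * (A.card : ℝ) ^ n := by
  intro n
  induction n with
  | zero => intro f _ _; simp
  | succ n ih =>
    intro f h0 hB
    have hsplit : ∑ c ∈ Fintype.piFinset (fun _ : Fin (n + 1) => A), (∑ i, f i (c i)) ^ 2
        = ∑ p ∈ A ×ˢ Fintype.piFinset (fun _ : Fin n => A),
          (f 0 p.1 + ∑ i, f (Fin.succ i) (p.2 i)) ^ 2 := by
      symm
      refine Finset.sum_bij' (fun p _ => Fin.cons p.1 p.2) (fun c _ => (c 0, Fin.tail c))
        ?_ ?_ ?_ ?_ ?_
      · rintro ⟨a, c⟩ h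
        simp only [Finset.mem_product, Fintype.mem_piFinset] at h ⊢
        intro i
        refine Fin.cases ?_ (fun i => ?_) i
        · simpa using h.1
        · simpa using h.2 i
      · intro c h
        simp only [Finset.mem_product, Fintype.mem_piFinset] at h ⊢
        exact ⟨h 0, fun i => h i.succ⟩
      · rintro ⟨a, c⟩ _; simp
      · intro c _; simp
      · rintro ⟨a, c⟩ _
        simp [Fin.sum_univ_succ]
    rw [hsplit, Finset.sum_product]
    have hcard : ((Fintype.piFinset fun _ : Fin n => A).card : ℝ) = (A.card : ℝ) ^ n := by simp
    have h1 : ∀ c ∈ Fintype.piFinset (fun _ : Fin n => A),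
        ∑ a ∈ A, (f 0 a + ∑ i, f (Fin.succ i) (c i)) ^ 2
          ≤ A.card * B + A.card * (∑ i, f (Fin.succ i) (c i)) ^ 2 := by
      intro c _
      have : ∑ a ∈ A, (f 0 a + ∑ i, f (Fin.succ i) (c i)) ^ 2
          = ∑ a ∈ A, f 0 a ^ 2 + 2 * (∑ a ∈ A, f 0 a) * (∑ i, f (Fin.succ i) (c i))
            + A.card * (∑ i, f (Fin.succ i) (c i)) ^ 2 := by
        generalize ∑ i, f (Fin.succ i) (c i) = S
        rw [Finset.mul_sum, Finset.sum_mul, ← nsmul_eq_mul, ← Finset.sum_const,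
          ← Finset.sum_add_distrib, ← Finset.sum_add_distrib]
        exact Finset.sum_congr rfl fun a _ => by ring
      -- Centring kills the cross term.
      rw [this, h0 0]
      have h2 : ∑ a ∈ A, f 0 a ^ 2 ≤ A.card * B := by
        rw [← nsmul_eq_mul]; exact Finset.sum_le_card_nsmul _ _ _ (hB 0)
      linarith
    rw [Finset.sum_comm]
    refine (Finset.sum_le_sum h1).trans ?_
    rw [Finset.sum_add_distrib, Finset.sum_const, nsmul_eq_mul, ← Finset.mul_sum, hcard]
    have h3 := mul_le_mul_of_nonneg_left (ih (fun i => f i.succ) (fun i => h0 _) (fun i => hB _))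
      (Nat.cast_nonneg (α := ℝ) A.card)
    refine (add_le_add_right h3 _).trans (le_of_eq ?_)
    push_cast; ring

/-- Cauchy–Schwarz: a map with few collisions has a large image. -/
theorem card_sq_le_card_image_mul {α β : Type*} [DecidableEq β] (S : Finset α) (f : α → β) :
    S.card ^ 2 ≤ (S.image f).card * ((S ×ˢ S).filter fun p => f p.1 = f p.2).card := by
  have h1 : S.card = ∑ v ∈ S.image f, (S.filter fun c => f c = v).card :=
    Finset.card_eq_sum_card_image f S
  have h2 : ((S ×ˢ S).filter fun p => f p.1 = f p.2).card
      = ∑ v ∈ S.image f, (S.filter fun c => f c = v).card ^ 2 := by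
    rw [Finset.card_eq_sum_card_fiberwise (f := fun p => f p.1) (t := S.image f)]
    · refine Finset.sum_congr rfl fun v _ => ?_
      rw [sq, ← Finset.card_product]
      congr 1
      ext ⟨a, b⟩
      simp only [Finset.mem_filter, Finset.mem_product]
      constructor
      · rintro ⟨⟨⟨ha, hb⟩, hab⟩, hv⟩
        exact ⟨⟨ha, hv⟩, hb, hab ▸ hv⟩
      · rintro ⟨⟨ha, hv⟩, hb, hv'⟩
        exact ⟨⟨⟨ha, hb⟩, hv.trans hv'.symm⟩, hv⟩
    · rintro ⟨a, b⟩ h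
      simp only [Finset.coe_filter, Finset.mem_product, Set.mem_ofPred_eq] at h
      exact Finset.mem_image_of_mem f h.1.1
  rw [h2, h1]
  exact sq_sum_le_card_mul_sum_sq

/-! ### Greedy signs -/

/-- Signs chosen greedily bring the running total within `M - 1` of `0`, and each final total is
attained by at most a `1 / M` fraction of the vectors. -/
theorem exists_greedy_signs (M : ℕ) (v : ℤ) (m : ℕ) :
    ∃ e : (Fin m → Fin M) → Fin m → ℤ, (∀ y i, e y i = 1 ∨ e y i = -1) ∧
      (∀ y, |v - ∑ i, (y i : ℤ) * e y i| ≤ max ((M : ℤ) - 1) (|v| - ∑ i, (y i : ℤ))) ∧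
      (0 < m → ∀ s, (Finset.univ.filter fun y => v - ∑ i, (y i : ℤ) * e y i = s).card * M
        ≤ M ^ m) := by
  induction m with
  | zero => exact ⟨fun _ => 0, by simp, by simp, by simp⟩
  | succ m ih =>
    obtain ⟨e, he, hv, -⟩ := ih
    -- The new sign opposes the current remainder and depends only on the earlier coordinates.
    set σ : (Fin m → Fin M) → ℤ := fun y => if 0 ≤ v - ∑ i, (y i : ℤ) * e y i then 1 else -1
      with hσ
    have hσ1 : ∀ y, σ y = 1 ∨ σ y = -1 := fun y => by
      simp only [hσ]; split_ifs <;> simp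
    have hsum : ∀ y : Fin (m + 1) → Fin M,
        ∑ i, (y i : ℤ) * (Fin.snoc (e (Fin.init y)) (σ (Fin.init y)) : Fin (m + 1) → ℤ) i
          = ∑ i, (Fin.init y i : ℤ) * e (Fin.init y) i + (y (Fin.last m) : ℤ) * σ (Fin.init y) := by
      intro y
      simp only [Fin.sum_univ_castSucc, Fin.snoc_castSucc, Fin.snoc_last]
      rfl
    refine ⟨fun y => Fin.snoc (e (Fin.init y)) (σ (Fin.init y)), fun y i => ?_, fun y => ?_,
      fun _ s => ?_⟩
    · refine Fin.lastCases ?_ (fun i => ?_) i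
      · simpa using hσ1 _
      · simpa using he _ i
    · rw [hsum]
      have h := hv (Fin.init y)
      have hy : (y (Fin.last m) : ℤ) ≤ M - 1 := by have := (y (Fin.last m)).2; omega
      have hy0 : (0 : ℤ) ≤ (y (Fin.last m) : ℤ) := by positivity
      have hT : ∑ i, (y i : ℤ) = ∑ i, (Fin.init y i : ℤ) + (y (Fin.last m) : ℤ) := by
        rw [Fin.sum_univ_castSucc]; rfl
      rw [hT]
      simp only [hσ]
      generalize ∑ i, (Fin.init y i : ℤ) * e (Fin.init y) i = S at h ⊢
      generalize ∑ i, (Fin.init y i : ℤ) = T at h ⊢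
      rw [le_max_iff] at h ⊢
      split_ifs with hs
      · rw [abs_of_nonneg hs] at h
        rw [abs_le, abs_le, mul_one]
        omega
      · rw [abs_of_neg (by omega)] at h
        rw [abs_le, abs_le, mul_neg_one]
        omega
    · have key : ((Finset.univ.filter fun y : Fin (m + 1) → Fin M => v - ∑ i, (y i : ℤ) *
          (Fin.snoc (e (Fin.init y)) (σ (Fin.init y)) : Fin (m + 1) → ℤ) i = s) ×ˢ
          (Finset.univ : Finset (Fin M))).card
          ≤ (Finset.univ : Finset (Fin (m + 1) → Fin M)).card := by
        apply Finset.card_le_card_of_injOn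
          (fun p => (Fin.snoc (Fin.init p.1) p.2 : Fin (m + 1) → Fin M)) (by simp)
        rintro ⟨x, t⟩ hx ⟨y, u⟩ hy hxy
        simp only [Finset.coe_product, Finset.coe_filter, Finset.mem_univ, true_and,
          Finset.coe_univ, Set.mem_prod, Set.mem_ofPred_eq, Set.mem_univ, and_true, hsum] at hx hy
        obtain ⟨h1, h2⟩ := Fin.snoc_inj.1 hxy
        rw [← h1] at hy
        -- The initial parts agree, hence so do the last signs, and the total determines the last
        -- coordinate.
        have h3 : (x (Fin.last m) : ℤ) = (y (Fin.last m) : ℤ) := by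
          rcases hσ1 (Fin.init x) with h | h <;> rw [h] at hx hy <;> linarith
        refine Prod.ext ?_ h2
        change x = y
        rw [← Fin.snoc_init_self x, ← Fin.snoc_init_self y, h1]
        congr 1
        exact Fin.ext (by omega)
      simpa [Finset.card_product] using key

/-! ### Density of the values attained on the main block -/

/-- On average over `x`, few pairs of coefficient vectors give the same value. -/
theorem sum_card_collisions_le (C : Finset ℤ) (n M : ℕ) (hM : M ≤ C.card ^ n) :
    (∑ x : Fin n → Fin M, (((Fintype.piFinset fun _ : Fin n => C) ×ˢ
      (Fintype.piFinset fun _ : Fin n => C)).filter fun p =>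
        ∑ i, (x i : ℤ) * p.1 i = ∑ i, (x i : ℤ) * p.2 i).card) * M
      ≤ 2 * (M ^ n * C.card ^ (2 * n)) := by
  classical
  set P := Fintype.piFinset fun _ : Fin n => C with hP
  have hPc : P.card = C.card ^ n := by simp [hP]
  have hswap : (∑ x : Fin n → Fin M, ((P ×ˢ P).filter fun p =>
        ∑ i, (x i : ℤ) * p.1 i = ∑ i, (x i : ℤ) * p.2 i).card)
      = ∑ p ∈ P ×ˢ P, (Finset.univ.filter fun x : Fin n → Fin M =>
        ∑ i, (x i : ℤ) * p.1 i = ∑ i, (x i : ℤ) * p.2 i).card := by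
    simp only [Finset.card_filter]
    exact Finset.sum_comm
  -- Off-diagonal pairs collide with probability at most `1 / M`. The diagonal contributes no more
  -- than the off-diagonal bound because `M ≤ |C| ^ n`, hence the factor `2`.
  have hpt : ∀ p ∈ P ×ˢ P, (Finset.univ.filter fun x : Fin n → Fin M =>
        ∑ i, (x i : ℤ) * p.1 i = ∑ i, (x i : ℤ) * p.2 i).card * M
      ≤ M ^ n + if p.1 = p.2 then M ^ n * M else 0 := by
    rintro ⟨c, c'⟩ _
    by_cases h : c = c'
    · subst h; simp
    · simp only [h, if_false, add_zero]
      obtain ⟨j, hj⟩ := Function.ne_iff.1 h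
      have := card_linear_eq_mul_le M (fun i => c i - c' i) j (sub_ne_zero.2 hj) 0
      rw [Fintype.card_fin] at this
      refine le_trans (le_of_eq ?_) this
      congr 2
      refine Finset.filter_congr fun x _ => ?_
      simp only [mul_sub, Finset.sum_sub_distrib, sub_eq_zero]
  rw [hswap, Finset.sum_mul]
  refine (Finset.sum_le_sum hpt).trans ?_
  rw [Finset.sum_add_distrib, Finset.sum_const, Finset.sum_product]
  have : ∀ c ∈ P, ∑ c' ∈ P, (if c = c' then M ^ n * M else 0) = M ^ n * M := by
    intro c hc; simp [hc]
  rw [Finset.sum_congr rfl this, Finset.sum_const, Finset.card_product, hPc, smul_eq_mul,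
    smul_eq_mul, two_mul n, pow_add]
  nlinarith [Nat.mul_le_mul_left (C.card ^ n * M ^ n) hM]

/-- Markov's inequality for a finite sum of natural numbers. -/
theorem card_filter_lt_mul_le {α : Type*} (A : Finset α) (f : α → ℕ) (t : ℕ) :
    (A.filter fun a => t < f a).card * t ≤ ∑ a ∈ A, f a := by
  calc (A.filter fun a => t < f a).card * t ≤ ∑ a ∈ A.filter fun a => t < f a, f a := by
        rw [← smul_eq_mul]
        exact Finset.card_nsmul_le_sum _ _ _ fun a ha => (Finset.mem_filter.1 ha).2.le
    _ ≤ ∑ a ∈ A, f a := Finset.sum_le_sum_of_subset (Finset.filter_subset _ _)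

/-- At least half of the coefficient vectors give a value of order `√n * M`. -/
theorem card_small_values (C : Finset ℤ) (d : ℕ) (hd : 0 < d) (hC : ∀ c ∈ C, |c| ≤ d)
    (h0 : ∑ c ∈ C, c = 0) (n M r : ℕ) (hn : 0 < n) (hr : n ≤ r ^ 2) (hM : 0 < M)
    (x : Fin n → Fin M) :
    C.card ^ n ≤ 2 * ((Fintype.piFinset fun _ : Fin n => C).filter fun c =>
      |∑ i, (x i : ℤ) * c i| ≤ (2 * d * r * M : ℕ)).card := by
  set P := Fintype.piFinset fun _ : Fin n => C with hP
  have hPc : P.card = C.card ^ n := by simp [hP]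
  have h2 := sum_sq_sum_le C ((M * d : ℝ) ^ 2) n (fun i c => (x i : ℝ) * c)
    (fun i => by rw [← Finset.mul_sum, ← Int.cast_sum, h0]; simp)
    (fun i c hc => by
      rw [mul_pow, mul_pow]
      have h1 : ((x i : ℕ) : ℝ) ≤ M := by exact_mod_cast (x i).2.le
      have h2 : |(c : ℝ)| ≤ d := by exact_mod_cast hC c hc
      have h3 : (c : ℝ) ^ 2 ≤ (d : ℝ) ^ 2 := by
        rw [← sq_abs]; exact pow_le_pow_left₀ (abs_nonneg _) h2 2
      have h4 : ((x i : ℕ) : ℝ) ^ 2 ≤ (M : ℝ) ^ 2 := pow_le_pow_left₀ (by positivity) h1 2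
      exact mul_le_mul h4 h3 (by positivity) (by positivity))
  -- Chebyshev at two standard deviations: at most a quarter of the coefficient vectors are
  -- excluded.
  have hbad : ((P.filter fun c => ¬ |∑ i, (x i : ℤ) * c i| ≤ (2 * d * r * M : ℕ)).card : ℝ)
      * (4 * n * (M * d : ℝ) ^ 2) ≤ n * (M * d : ℝ) ^ 2 * (C.card : ℝ) ^ n := by
    refine le_trans ?_ h2
    refine le_trans ?_ (Finset.sum_le_sum_of_subset_of_nonneg (Finset.filter_subset
      (fun c => ¬ |∑ i, (x i : ℤ) * c i| ≤ (2 * d * r * M : ℕ)) P) fun _ _ _ => sq_nonneg _)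
    rw [← nsmul_eq_mul]
    refine Finset.card_nsmul_le_sum _ _ _ fun c hc => ?_
    have h3 := not_le.1 (Finset.mem_filter.1 hc).2
    have h4 : ((2 * d * r * M : ℕ) : ℝ) ≤ |∑ i, ((x i : ℕ) : ℝ) * c i| := by
      exact_mod_cast h3.le
    rw [← sq_abs (∑ i, _)]
    refine le_trans ?_ (pow_le_pow_left₀ (by positivity) h4 2)
    have hr' : (n : ℝ) ≤ (r : ℝ) ^ 2 := by exact_mod_cast hr
    push_cast
    nlinarith [mul_le_mul_of_nonneg_right hr' (sq_nonneg (M * d : ℝ))]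
  have hpos : (0 : ℝ) < n * (M * d : ℝ) ^ 2 := by positivity
  have h5 : 4 * (P.filter fun c => ¬ |∑ i, (x i : ℤ) * c i| ≤ (2 * d * r * M : ℕ)).card
      ≤ C.card ^ n := by
    have : (4 : ℝ) * ((P.filter fun c => ¬ |∑ i, (x i : ℤ) * c i| ≤ (2 * d * r * M : ℕ)).card : ℝ)
      ≤ (C.card : ℝ) ^ n := by
      refine le_of_mul_le_mul_left ?_ hpos
      linarith
    exact_mod_cast this
  have h6 := Finset.card_filter_add_card_filter_not (s := P)
    (fun c => |∑ i, (x i : ℤ) * c i| ≤ (2 * d * r * M : ℕ))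
  omega

/-- A set of integers in `[-R M, R M]` is dense in some short window. -/
theorem exists_window (V : Finset ℤ) (R M K L : ℕ) (hV : ∀ v ∈ V, |v| ≤ (R * M : ℕ))
    (hL : 0 < L) (hLM : L ≤ M) (hK : M ≤ K * L) :
    ∃ a : ℤ, |a| ≤ ((R + 1) * M : ℕ) ∧
      V.card ≤ (2 * R * K + 1) * (V.filter fun v => a ≤ v ∧ v < a + L).card := by
  classical
  rcases V.eq_empty_or_nonempty with rfl | hne
  · exact ⟨0, by simp, by simp⟩
  have hLz : (0 : ℤ) < L := by exact_mod_cast hL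
  -- Pigeonhole over the buckets `[qL, (q+1)L)`, whose indices lie in `[-RK, RK]`.
  set T := V.image fun v => v / (L : ℤ) with hT
  have hTc : T.card ≤ 2 * R * K + 1 := by
    have hsub : T ⊆ Finset.Icc (-((R * K : ℕ) : ℤ)) ((R * K : ℕ) : ℤ) := by
      intro t ht
      obtain ⟨v, hv, rfl⟩ := Finset.mem_image.1 ht
      have h1 := abs_le.1 (hV v hv)
      have h2 : ((R * M : ℕ) : ℤ) ≤ (R * K : ℕ) * L := by
        have := Nat.mul_le_mul_left R hK
        rw [← mul_assoc] at this
        exact_mod_cast this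
      rw [Finset.mem_Icc]
      constructor
      · rw [Int.le_ediv_iff_mul_le hLz]; linarith
      · apply Int.ediv_le_of_le_mul hLz; linarith
    have := Finset.card_le_card hsub
    rw [Int.card_Icc] at this
    have h3 : 2 * R * K = 2 * (R * K) := by ring
    omega
  by_contra! hcon
  have hlt : ∀ t ∈ T, (2 * R * K + 1) * (V.filter fun v => v / (L : ℤ) = t).card < V.card := by
    intro t ht
    obtain ⟨v, hv, rfl⟩ := Finset.mem_image.1 ht
    have hdm := Int.emod_add_mul_ediv v L
    have hm0 := Int.emod_nonneg v hLz.ne'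
    have hm1 := Int.emod_lt_of_pos v hLz
    have h1 := abs_le.1 (hV v hv)
    have h := hcon (L * (v / L)) (by
      rw [abs_le]; push_cast at h1 ⊢
      constructor <;> nlinarith)
    refine lt_of_le_of_lt ?_ h
    refine Nat.mul_le_mul_left _ (Finset.card_le_card ?_)
    intro u hu
    rw [Finset.mem_filter] at hu ⊢
    refine ⟨hu.1, ?_⟩
    have hdm := Int.emod_add_mul_ediv u L
    have hm0 := Int.emod_nonneg u hLz.ne'
    have hm1 := Int.emod_lt_of_pos u hLz
    rw [← hu.2]
    constructor <;> linarith
  have hsum : V.card = ∑ t ∈ T, (V.filter fun v => v / (L : ℤ) = t).card :=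
    Finset.card_eq_sum_card_image _ V
  have hTne : T.Nonempty := hne.image _
  have h4 : (2 * R * K + 1) * V.card < T.card * V.card := by
    conv_lhs => rw [hsum]
    rw [Finset.mul_sum, ← smul_eq_mul T.card, ← Finset.sum_const]
    exact Finset.sum_lt_sum_of_nonempty hTne hlt
  exact absurd (Nat.mul_le_mul_right V.card hTc) (not_le.2 h4)

/-- For all but a `1 / w` fraction of the vectors `x`, the values `x · c` are dense in some window
of length `L` near the origin. -/
theorem card_not_dense_window_le (C : Finset ℤ) (d : ℕ) (hd : 0 < d) (hC : ∀ c ∈ C, |c| ≤ d)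
    (h0 : ∑ c ∈ C, c = 0) (hne : C.Nonempty) (n M r w K L : ℕ) (hn : 0 < n) (hr : n ≤ r ^ 2)
    (hM : 0 < M) (hMC : M ≤ C.card ^ n)
    (hL : 0 < L) (hLM : L ≤ M) (hK : M ≤ K * L) (p : (Fin n → Fin M) → Prop) [DecidablePred p]
    (hp : ∀ x, (∃ (a : ℤ) (G : Finset ℤ), |a| ≤ ((2 * d * r + 1) * M : ℕ) ∧
      (∀ g ∈ G, a ≤ g ∧ g < a + L ∧ ∃ c : Fin n → ℤ, (∀ i, c i ∈ C) ∧ ∑ i, (x i : ℤ) * c i = g) ∧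
      M ≤ 8 * w * (2 * (2 * d * r) * K + 1) * G.card) → p x) :
    (Finset.univ.filter fun x => ¬ p x).card * w ≤ M ^ n := by
  classical
  set P := Fintype.piFinset fun _ : Fin n => C with hP
  have hCpos : 0 < C.card ^ n := pow_pos hne.card_pos _
  set f : (Fin n → Fin M) → ℕ := fun x => ((P ×ˢ P).filter fun p =>
        ∑ i, (x i : ℤ) * p.1 i = ∑ i, (x i : ℤ) * p.2 i).card * M with hf
  have hsub : (Finset.univ.filter fun x => ¬ p x)
      ⊆ Finset.univ.filter fun x => 2 * w * C.card ^ (2 * n) < f x := by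
    intro x hx
    rw [Finset.mem_filter] at hx ⊢
    refine ⟨hx.1, ?_⟩
    by_contra! hcol
    apply hx.2
    apply hp
    set S := P.filter fun c => |∑ i, (x i : ℤ) * c i| ≤ (2 * d * r * M : ℕ) with hS
    have hSc := card_small_values C d hd hC h0 n M r hn hr hM x
    set V := S.image fun c => ∑ i, (x i : ℤ) * c i with hV
    obtain ⟨a, ha, hcard⟩ := exists_window V (2 * d * r) M K L (by
      intro v hv
      obtain ⟨c, hc, rfl⟩ := Finset.mem_image.1 hv
      exact (Finset.mem_filter.1 hc).2) hL hLM hK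
    refine ⟨a, V.filter fun v => a ≤ v ∧ v < a + L, ha, ?_, ?_⟩
    · intro g hg
      obtain ⟨hgV, h1, h2⟩ := Finset.mem_filter.1 hg
      obtain ⟨c, hc, rfl⟩ := Finset.mem_image.1 hgV
      exact ⟨h1, h2, c, Fintype.mem_piFinset.1 (Finset.mem_filter.1 hc).1, rfl⟩
    · have hcs := card_sq_le_card_image_mul S fun c => ∑ i, (x i : ℤ) * c i
      have hcoll : ((S ×ˢ S).filter fun p =>
          ∑ i, (x i : ℤ) * p.1 i = ∑ i, (x i : ℤ) * p.2 i).card * M ≤ f x := by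
        refine Nat.mul_le_mul_right _ (Finset.card_le_card (Finset.filter_subset_filter _ ?_))
        exact Finset.product_subset_product (Finset.filter_subset _ _) (Finset.filter_subset _ _)
      -- In the constant `8`, a factor `4` comes from squaring the loss of half the vectors and `2`
      -- from the collision bound.
      have h1 : C.card ^ (2 * n) * M ≤ C.card ^ (2 * n) * (8 * w * V.card) := by
        calc C.card ^ (2 * n) * M = (C.card ^ n) ^ 2 * M := by ring
          _ ≤ (2 * S.card) ^ 2 * M := by gcongr
          _ = 4 * (S.card ^ 2 * M) := by ring
          _ ≤ 4 * (V.card * ((S ×ˢ S).filter fun p =>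
              ∑ i, (x i : ℤ) * p.1 i = ∑ i, (x i : ℤ) * p.2 i).card * M) := by gcongr
          _ = 4 * V.card * (((S ×ˢ S).filter fun p =>
              ∑ i, (x i : ℤ) * p.1 i = ∑ i, (x i : ℤ) * p.2 i).card * M) := by ring
          _ ≤ 4 * V.card * (2 * w * C.card ^ (2 * n)) := by
              exact Nat.mul_le_mul_left _ (hcoll.trans hcol)
          _ = _ := by ring
      have h2 := Nat.le_of_mul_le_mul_left h1 (by positivity)
      calc M ≤ 8 * w * V.card := h2
        _ ≤ 8 * w * ((2 * (2 * d * r) * K + 1) *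
            (V.filter fun v => a ≤ v ∧ v < a + L).card) := by gcongr
        _ = _ := by ring
  have hmk := card_filter_lt_mul_le Finset.univ f (2 * w * C.card ^ (2 * n))
  have hsum : ∑ x, f x ≤ 2 * (M ^ n * C.card ^ (2 * n)) := by
    rw [← Finset.sum_mul]
    exact sum_card_collisions_le C n M hMC
  have h3 := (Nat.mul_le_mul_right (2 * w * C.card ^ (2 * n)) (Finset.card_le_card hsub)).trans
    (hmk.trans hsum)
  have hpos : 0 < 2 * C.card ^ (2 * n) := by positivity
  refine Nat.le_of_mul_le_mul_left ?_ hpos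
  calc _ = _ := by ring
    _ ≤ _ := h3
    _ = _ := by ring

/-! ### Reaching the dense window -/

/-- A fixed total `s` is rarely missed by all single-coordinate modifications. -/
theorem card_all_miss_le (M k L Γ : ℕ) (a s : ℤ) (G : Finset ℤ)
    (hG : ∀ g ∈ G, a ≤ g ∧ g < a + L) (hΓ : M ≤ Γ * G.card) (hΓ0 : 0 < Γ)
    (hs1 : a + L - M ≤ s) (hs2 : s ≤ a + M - 1) :
    ((Finset.univ.filter fun z : Fin k → Fin M × Fin M =>
      ∀ i, s - ((z i).1 : ℤ) ∉ G ∧ s + ((z i).2 : ℤ) ∉ G).card : ℝ)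
      ≤ ((M : ℝ) ^ 2 * (1 - 1 / (2 * Γ))) ^ k := by
  classical
  set A : Finset (Fin M) := Finset.univ.filter fun u => s - (u : ℤ) ∉ G with hA
  set B : Finset (Fin M) := Finset.univ.filter fun u => s + (u : ℤ) ∉ G with hB
  have hset : (Finset.univ.filter fun z : Fin k → Fin M × Fin M =>
      ∀ i, s - ((z i).1 : ℤ) ∉ G ∧ s + ((z i).2 : ℤ) ∉ G)
      = Fintype.piFinset fun _ : Fin k => A ×ˢ B := by
    ext z
    simp [hA, hB, Fintype.mem_piFinset]
  rw [hset, Fintype.card_piFinset]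
  simp only [Finset.prod_const, Finset.card_univ, Fintype.card_fin, Finset.card_product,
    Nat.cast_pow, Nat.cast_mul]
  refine pow_le_pow_left₀ (by positivity) ?_ k
  have hA' := Finset.card_filter_add_card_filter_not (s := (Finset.univ : Finset (Fin M)))
    (fun u => s - (u : ℤ) ∉ G)
  have hB' := Finset.card_filter_add_card_filter_not (s := (Finset.univ : Finset (Fin M)))
    (fun u => s + (u : ℤ) ∉ G)
  rw [← hA] at hA'
  rw [← hB] at hB'
  simp only [not_not, Finset.card_univ, Fintype.card_fin] at hA' hB'
  -- Every point of `G` is within `M - 1` of `s`, so it is reached either from above by a first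
  -- entry or from below by a second one.
  have hcov : G ⊆ (Finset.univ.filter fun u : Fin M => s - (u : ℤ) ∈ G).image
        (fun u : Fin M => s - (u : ℤ))
      ∪ (Finset.univ.filter fun u : Fin M => s + (u : ℤ) ∈ G).image (fun u : Fin M => s + (u : ℤ)) := by
    intro g hg
    obtain ⟨h1, h2⟩ := hG g hg
    rw [Finset.mem_union]
    by_cases h : g ≤ s
    · left
      have e : s - (((s - g).toNat : ℕ) : ℤ) = g := by omega
      exact Finset.mem_image.2 ⟨⟨(s - g).toNat, by omega⟩, by
        rw [Finset.mem_filter]; exact ⟨Finset.mem_univ _, e.symm ▸ hg⟩, e⟩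
    · right
      have e : s + (((g - s).toNat : ℕ) : ℤ) = g := by omega
      exact Finset.mem_image.2 ⟨⟨(g - s).toNat, by omega⟩, by
        rw [Finset.mem_filter]; exact ⟨Finset.mem_univ _, e.symm ▸ hg⟩, e⟩
  have hc := (Finset.card_le_card hcov).trans ((Finset.card_union_le _ _).trans
    (add_le_add Finset.card_image_le Finset.card_image_le))
  generalize (Finset.univ.filter fun u : Fin M => s - (u : ℤ) ∈ G).card = p at hc hA'
  generalize (Finset.univ.filter fun u : Fin M => s + (u : ℤ) ∈ G).card = q at hc hB'
  have hΓr : (0 : ℝ) < Γ := by exact_mod_cast hΓ0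
  have e1 : (A.card : ℝ) = M - p := by rw [eq_sub_iff_add_eq]; exact_mod_cast hA'
  have e2 : (B.card : ℝ) = M - q := by rw [eq_sub_iff_add_eq]; exact_mod_cast hB'
  have hA0 : (0 : ℝ) ≤ A.card := by positivity
  have hB0 : (0 : ℝ) ≤ B.card := by positivity
  have h1 : (M : ℝ) / Γ ≤ p + q := by
    rw [div_le_iff₀ hΓr]
    have : (M : ℝ) ≤ Γ * G.card := by exact_mod_cast hΓ
    have h' : (G.card : ℝ) ≤ p + q := by exact_mod_cast hc
    nlinarith
  have h2 : (M : ℝ) ^ 2 * (1 - 1 / (2 * Γ)) = M ^ 2 - M * (M / Γ) / 2 := by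
    field_simp
  rw [h2]
  have hM0 : (0 : ℝ) ≤ M := by positivity
  have hp0 : (0 : ℝ) ≤ p := by positivity
  have hq0 : (0 : ℝ) ≤ q := by positivity
  -- Averaging this bound and the next replaces the product by `M` times the mean of the two
  -- cardinalities, which sees only `p + q`.
  have h3 : (A.card : ℝ) * B.card ≤ M * B.card := by nlinarith
  have h4 : (A.card : ℝ) * B.card ≤ A.card * M := by nlinarith
  nlinarith [mul_le_mul_of_nonneg_left h1 hM0]

/-- The auxiliary coordinates `z`, `y` carry the target `τ` into `G` for most `z`, `y`. -/
theorem card_not_reach_le (M k m L Γ D : ℕ) (a τ : ℤ) (G : Finset ℤ) (hM : 0 < M) (hm : 0 < m)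
    (hG : ∀ g ∈ G, a ≤ g ∧ g < a + L) (hΓ : M ≤ Γ * G.card) (hΓ0 : 0 < Γ)
    (hD : |τ| + |a| + k * M ≤ D)
    (p : (Fin k → Fin M × Fin M) → (Fin m → Fin M) → Prop) [∀ z y, Decidable (p z y)]
    (hp : ∀ z y, (∃ (b b' : Fin k → ℤ) (e : Fin m → ℤ), (∀ i, b i = 1 ∨ b i = 2) ∧
      (∀ i, b' i = -1 ∨ b' i = -2) ∧ (∀ i, e i = 1 ∨ e i = -1) ∧
      τ - ∑ i, (((z i).1 : ℤ) * b i + ((z i).2 : ℤ) * b' i) - ∑ i, (y i : ℤ) * e i ∈ G) → p z y) :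
    ((Finset.univ.filter fun q : (Fin k → Fin M × Fin M) × (Fin m → Fin M) =>
      (D : ℤ) ≤ ∑ i, (q.2 i : ℤ) ∧ ¬ p q.1 q.2).card : ℝ) * M
      ≤ (M : ℝ) ^ (2 * k + m) * ((L - 1 : ℕ) + 2 * M * (1 - 1 / (2 * Γ)) ^ k) := by
  classical
  set J := Finset.Icc (a + L - M) (a + M - 1) with hJ
  -- `E` holds the `L - 1` totals within `M - 1` of `a` that are too far left to reach the whole
  -- window; from `J` every point of the window is reachable.
  set E := Finset.Icc (a - M + 1) (a + L - M - 1) with hE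
  set miss : (Fin k → Fin M × Fin M) → ℤ → Prop := fun z s =>
    ∀ i, s - ((z i).1 : ℤ) ∉ G ∧ s + ((z i).2 : ℤ) ∉ G with hmiss
  have hfib : ∀ z : Fin k → Fin M × Fin M,
      (Finset.univ.filter fun y : Fin m → Fin M =>
        (D : ℤ) ≤ ∑ i, (y i : ℤ) ∧ ¬ p z y).card * M
      ≤ (E.card + (J.filter (miss z)).card) * M ^ m := by
    intro z
    set Z : ℤ := ∑ i, (((z i).1 : ℤ) - ((z i).2 : ℤ)) with hZ
    have hZabs : |Z| ≤ k * M := by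
      refine (Finset.abs_sum_le_sum_abs _ _).trans ?_
      refine (Finset.sum_le_card_nsmul _ _ (M : ℤ) fun i _ => ?_).trans (by simp)
      have h1 := (z i).1.2
      have h2 := (z i).2.2
      rw [abs_le]; omega
    obtain ⟨e, he, hea, hes⟩ := exists_greedy_signs M (τ - Z - a) m
    have hsub : (Finset.univ.filter fun y : Fin m → Fin M =>
        (D : ℤ) ≤ ∑ i, (y i : ℤ) ∧ ¬ p z y)
        ⊆ (E ∪ J.filter (miss z)).biUnion fun s => Finset.univ.filter fun y =>
          τ - Z - a - ∑ i, (y i : ℤ) * e y i = s - a := by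
      intro y hy
      obtain ⟨-, hDy, hpy⟩ := Finset.mem_filter.1 hy
      set t := τ - Z - ∑ i, (y i : ℤ) * e y i with ht
      simp only [Finset.mem_biUnion, Finset.mem_filter, Finset.mem_univ, true_and]
      refine ⟨t, ?_, by rw [ht]; ring⟩
      have h1 : |t - a| ≤ M - 1 := by
        have h2 : |τ - Z - a| ≤ D := by
          have h3 := abs_sub (τ - Z) a
          have h4 := abs_sub τ Z
          linarith
        have h5 := hea y
        rw [max_eq_left (by omega)] at h5
        convert h5 using 2
        rw [ht]; ring
      rw [abs_le] at h1
      rw [Finset.mem_union]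
      by_cases htJ : t < a + L - M
      · left; rw [hE, Finset.mem_Icc]; omega
      · right
        rw [Finset.mem_filter]
        refine ⟨by rw [hJ, Finset.mem_Icc]; omega, ?_⟩
        intro j
        by_contra hj
        apply hpy
        apply hp
        -- `Z` is the contribution of the base coefficients `(1, -1)`. Taking `β = 1` lowers the
        -- total by the first entry of pair `j`; taking `β' = 1` raises it by the second.
        have hbase : ∀ β β' : ℤ, ∑ i, (((z i).1 : ℤ) * (1 + if i = j then β else 0)
            + ((z i).2 : ℤ) * (-1 - if i = j then β' else 0))
            = Z + ((z j).1 : ℤ) * β - ((z j).2 : ℤ) * β' := by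
          intro β β'
          have : ∀ i, (((z i).1 : ℤ) * (1 + if i = j then β else 0)
            + ((z i).2 : ℤ) * (-1 - if i = j then β' else 0))
            = (((z i).1 : ℤ) - ((z i).2 : ℤ))
              + (if i = j then ((z i).1 : ℤ) * β - ((z i).2 : ℤ) * β' else 0) := by
            intro i; split_ifs <;> ring
          rw [Finset.sum_congr rfl fun i _ => this i, Finset.sum_add_distrib]
          simp [hZ, add_sub_assoc]
        rw [not_and_or, not_not, not_not] at hj
        rcases hj with hj | hj
        · refine ⟨fun i => 1 + if i = j then 1 else 0, fun i => -1 - if i = j then 0 else 0, e y,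
            fun i => ?_, fun i => ?_, he y, ?_⟩
          · by_cases h : i = j <;> simp [h]
          · simp
          · rw [hbase]
            convert hj using 1
            rw [ht]; ring
        · refine ⟨fun i => 1 + if i = j then 0 else 0, fun i => -1 - if i = j then 1 else 0, e y,
            fun i => ?_, fun i => ?_, he y, ?_⟩
          · simp
          · by_cases h : i = j <;> simp [h]
          · rw [hbase]
            convert hj using 1
            rw [ht]; ring
    calc _ ≤ (∑ s ∈ E ∪ J.filter (miss z), (Finset.univ.filter fun y =>
          τ - Z - a - ∑ i, (y i : ℤ) * e y i = s - a).card) * M :=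
          Nat.mul_le_mul_right _ ((Finset.card_le_card hsub).trans Finset.card_biUnion_le)
      _ ≤ (E ∪ J.filter (miss z)).card * M ^ m := by
          rw [Finset.sum_mul, ← smul_eq_mul]
          exact Finset.sum_le_card_nsmul _ _ _ fun s _ => hes hm _
      _ ≤ _ := Nat.mul_le_mul_right _ (Finset.card_union_le _ _)
  -- Exchanging the sums over `z` and `s` removes the dependence of the total on `z`: each `s` is
  -- now fixed while `z` varies.
  have htot : (Finset.univ.filter fun q : (Fin k → Fin M × Fin M) × (Fin m → Fin M) =>
      (D : ℤ) ≤ ∑ i, (q.2 i : ℤ) ∧ ¬ p q.1 q.2).card * M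
      ≤ (M ^ (2 * k) * E.card + ∑ s ∈ J, (Finset.univ.filter fun z => miss z s).card) * M ^ m := by
    have e1 : (Finset.univ.filter fun q : (Fin k → Fin M × Fin M) × (Fin m → Fin M) =>
        (D : ℤ) ≤ ∑ i, (q.2 i : ℤ) ∧ ¬ p q.1 q.2).card
        = ∑ z : Fin k → Fin M × Fin M, (Finset.univ.filter fun y : Fin m → Fin M =>
        (D : ℤ) ≤ ∑ i, (y i : ℤ) ∧ ¬ p z y).card := by
      simp only [Finset.card_filter]
      exact Fintype.sum_prod_type _
    rw [e1, Finset.sum_mul]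
    refine (Finset.sum_le_sum fun z _ => hfib z).trans (le_of_eq ?_)
    rw [← Finset.sum_mul, Finset.sum_add_distrib]
    congr 2
    · simp [pow_mul, sq]
    · simp only [Finset.card_filter]
      exact Finset.sum_comm
  have hEc : E.card = L - 1 := by rw [hE, Int.card_Icc]; omega
  have hJc : J.card ≤ 2 * M := by rw [hJ, Int.card_Icc]; omega
  have hsumJ : ((∑ s ∈ J, (Finset.univ.filter fun z => miss z s).card : ℕ) : ℝ)
      ≤ 2 * M * ((M : ℝ) ^ 2 * (1 - 1 / (2 * Γ))) ^ k := by
    push_cast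
    have hρ : (0 : ℝ) ≤ 1 - 1 / (2 * Γ) := by
      have : (1 : ℝ) ≤ Γ := by exact_mod_cast hΓ0
      rw [sub_nonneg, div_le_one (by positivity)]; linarith
    refine (Finset.sum_le_card_nsmul J _ (((M : ℝ) ^ 2 * (1 - 1 / (2 * Γ))) ^ k)
      fun s hs => ?_).trans ?_
    · rw [hJ, Finset.mem_Icc] at hs
      exact card_all_miss_le M k L Γ a s G hG hΓ hΓ0 hs.1 hs.2
    · rw [nsmul_eq_mul]
      refine mul_le_mul_of_nonneg_right (by exact_mod_cast hJc) (by positivity)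
  calc _ ≤ (((M ^ (2 * k) * E.card + ∑ s ∈ J, (Finset.univ.filter fun z => miss z s).card)
        * M ^ m : ℕ) : ℝ) := by exact_mod_cast htot
    _ ≤ ((M : ℝ) ^ (2 * k) * (L - 1 : ℕ) + 2 * M * ((M : ℝ) ^ 2 * (1 - 1 / (2 * Γ))) ^ k)
        * (M : ℝ) ^ m := by
        rw [Nat.cast_mul, Nat.cast_add, Nat.cast_mul, hEc]
        push_cast at hsumJ ⊢
        gcongr
    _ = _ := by rw [mul_pow]; ring

/-- The coordinate sum of a uniform vector is rarely below a quarter of its mean. -/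
theorem card_small_sum_le (M m D : ℕ) (hM : 2 ≤ M) (hD : 8 * D ≤ m * M) :
    (Finset.univ.filter fun y : Fin m → Fin M => ¬ (D : ℤ) ≤ ∑ i, (y i : ℤ)).card * m
      ≤ 64 * M ^ m := by
  classical
  have hMr : (2 : ℝ) ≤ M := by exact_mod_cast hM
  set μ : ℝ := ((M : ℝ) - 1) / 2 with hμ
  have hsum0 : ∑ u : Fin M, ((u : ℝ) - μ) = 0 := by
    rw [Finset.sum_sub_distrib, Fin.sum_univ_eq_sum_range (fun u => (u : ℝ)) M]
    have h := Finset.sum_range_id_mul_two M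
    have h' : ((∑ i ∈ Finset.range M, i : ℕ) : ℝ) * 2 = M * ((M : ℝ) - 1) := by
      rw [← Nat.cast_pred (by omega : 0 < M)]; exact_mod_cast h
    push_cast at h'
    simp only [Finset.sum_const, Finset.card_univ, Fintype.card_fin, nsmul_eq_mul, hμ]
    linarith
  have h2 := sum_sq_sum_le (Finset.univ : Finset (Fin M)) ((M : ℝ) ^ 2) m
    (fun _ u => (u : ℝ) - μ) (fun _ => hsum0) (fun _ u _ => by
      have h1 : ((u : ℕ) : ℝ) ≤ M := by exact_mod_cast u.2.le
      have h0 : (0 : ℝ) ≤ ((u : ℕ) : ℝ) := by positivity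
      rw [← sq_abs]
      refine pow_le_pow_left₀ (abs_nonneg _) ?_ 2
      rw [abs_le, hμ]; constructor <;> linarith)
  rw [Fintype.piFinset_univ] at h2
  simp only [Finset.card_univ, Fintype.card_fin] at h2
  rcases Nat.eq_zero_or_pos m with rfl | hm
  · simp
  have hmr : (0 : ℝ) < m := by exact_mod_cast hm
  -- Since `M ≥ 2`, the mean `m * μ` is at least `m * M / 4`, so a sum below `D ≤ m * M / 8` falls
  -- short by at least `m * M / 8`.
  have hbad : ((Finset.univ.filter fun y : Fin m → Fin M =>
      ¬ (D : ℤ) ≤ ∑ i, (y i : ℤ)).card : ℝ) * (m * M / 8 : ℝ) ^ 2 ≤ m * M ^ 2 * (M : ℝ) ^ m := by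
    refine le_trans ?_ h2
    refine le_trans ?_ (Finset.sum_le_sum_of_subset_of_nonneg (Finset.filter_subset
      (fun y => ¬ (D : ℤ) ≤ ∑ i, (y i : ℤ)) _) fun _ _ _ => sq_nonneg _)
    rw [← nsmul_eq_mul]
    refine Finset.card_nsmul_le_sum _ _ _ fun y hy => ?_
    have h3 := not_le.1 (Finset.mem_filter.1 hy).2
    have h4 : ∑ i, ((y i : ℕ) : ℝ) ≤ D := by exact_mod_cast h3.le
    have h5 : (8 : ℝ) * D ≤ m * M := by exact_mod_cast hD
    rw [Finset.sum_sub_distrib]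
    simp only [Finset.sum_const, Finset.card_univ, Fintype.card_fin, nsmul_eq_mul]
    rw [← sq_abs (∑ i, _ - _)]
    refine pow_le_pow_left₀ (by positivity) ?_ 2
    rw [abs_of_nonpos] <;> rw [hμ] <;> nlinarith
  have : ((Finset.univ.filter fun y : Fin m → Fin M =>
      ¬ (D : ℤ) ≤ ∑ i, (y i : ℤ)).card : ℝ) * m ≤ 64 * (M : ℝ) ^ m := by
    refine le_of_mul_le_mul_left ?_ (by positivity : (0 : ℝ) < m * M ^ 2)
    nlinarith
  exact_mod_cast this

/-! ### The coefficient set and the probability as a count -/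

theorem card_coeffSet (d : ℕ) : (coeffSet d).card = 2 * d := by
  rw [coeffSet, Finset.card_erase_of_mem (by simp), Int.card_Icc]
  omega

theorem mem_coeffSet {d : ℕ} {c : ℤ} : c ∈ coeffSet d ↔ c ≠ 0 ∧ |c| ≤ d := by
  rw [coeffSet, Finset.mem_erase, Finset.mem_Icc, abs_le]

theorem sum_coeffSet (d : ℕ) : ∑ c ∈ coeffSet d, c = 0 := by
  have h : ∑ c ∈ coeffSet d, c = ∑ c ∈ coeffSet d, -c :=
    Finset.sum_bij' (fun c _ => -c) (fun c _ => -c) (by simp [mem_coeffSet]) (by simp [mem_coeffSet])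
      (by simp) (by simp) (by simp)
  rw [Finset.sum_neg_distrib] at h
  omega

/-- Transfers the uniform measure on integer vectors to counting in `Fin n → Fin M`, where all
estimates are made. -/
theorem solutionProb_eq (C : Finset ℤ) (n M : ℕ) (τ : ℤ)
    [DecidablePred fun x : Fin n → Fin M => HasSolution C τ fun i => (x i : ℤ)] :
    solutionProb C n M τ
      = ((Finset.univ.filter fun x : Fin n → Fin M => HasSolution C τ fun i => (x i : ℤ)).card : ℝ)
        / (M : ℝ) ^ n := by
  classical
  set F : (Fin n → Fin M) → (Fin n → ℤ) := fun x i => (x i : ℤ) with hF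
  have hinj : Function.Injective F := fun x y h => funext fun i => Fin.ext (by
    have := congrFun h i
    simpa [hF] using this)
  have himg : inputVectors n M = ((Finset.univ.image F : Finset (Fin n → ℤ)) : Set _) := by
    ext x
    simp only [inputVectors, Set.mem_Icc, Set.mem_ofPred_eq, Finset.coe_image, Finset.coe_univ,
      Set.image_univ, Set.mem_range]
    constructor
    · intro h
      refine ⟨fun i => ⟨(x i).toNat, by have := h i; omega⟩, funext fun i => ?_⟩
      have := h i
      simp only [hF]
      omega
    · rintro ⟨u, rfl⟩ i
      have := (u i).2
      simp only [hF]
      omega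
  have hinter : inputVectors n M ∩ {x | HasSolution C τ x}
      = (((Finset.univ.filter fun x : Fin n → Fin M => HasSolution C τ fun i => (x i : ℤ)).image F :
        Finset (Fin n → ℤ)) : Set _) := by
    rw [himg]
    ext x
    simp only [Finset.coe_image, Finset.coe_univ, Set.image_univ, Set.mem_inter_iff, Set.mem_range,
      Set.mem_ofPred_eq, Finset.coe_filter, Finset.mem_univ, true_and, Set.mem_image]
    constructor
    · rintro ⟨⟨u, rfl⟩, h⟩; exact ⟨u, h, rfl⟩
    · rintro ⟨u, h, rfl⟩; exact ⟨⟨u, rfl⟩, h⟩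
  rw [solutionProb, MeasureTheory.measureReal_def, ProbabilityTheory.uniformOn,
    ProbabilityTheory.cond_apply (by rw [himg]; exact Finset.measurableSet _), hinter, himg,
    MeasureTheory.Measure.count_apply_finset, MeasureTheory.Measure.count_apply_finset,
    Finset.card_image_of_injective _ hinj, Finset.card_image_of_injective _ hinj]
  simp [div_eq_inv_mul]

/-! ### Combining the blocks -/

/-- Splitting the coordinates into a main block, pairs, and a greedy block. -/
theorem hasSolution_of_blocks {n n₁ k m M : ℕ} (C : Finset ℤ) (τ : ℤ)
    (σ : Fin n₁ ⊕ ((Fin k ⊕ Fin k) ⊕ Fin m) ≃ Fin n) (x : Fin n → Fin M)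
    (h : ∃ (c : Fin n₁ → ℤ) (b b' : Fin k → ℤ) (e : Fin m → ℤ), (∀ i, c i ∈ C) ∧ (∀ i, b i ∈ C) ∧
      (∀ i, b' i ∈ C) ∧ (∀ i, e i ∈ C) ∧
      ∑ i, (x (σ (.inl i)) : ℤ) * c i
        = τ - ∑ i, ((x (σ (.inr (.inl (.inl i)))) : ℤ) * b i
          + (x (σ (.inr (.inl (.inr i)))) : ℤ) * b' i)
          - ∑ i, (x (σ (.inr (.inr i))) : ℤ) * e i) :
    HasSolution C τ fun i => (x i : ℤ) := by
  obtain ⟨c, b, b', e, hc, hb, hb', he, hsum⟩ := h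
  refine ⟨fun i => Sum.elim c (Sum.elim (Sum.elim b b') e) (σ.symm i), fun i => ?_, ?_⟩
  · change Sum.elim c (Sum.elim (Sum.elim b b') e) (σ.symm i) ∈ C
    rcases σ.symm i with i | (i | i) | i
    · exact hc i
    · exact hb i
    · exact hb' i
    · exact he i
  · rw [dotProduct, ← Equiv.sum_comp σ]
    simp only [Equiv.symm_apply_apply, Fintype.sum_sum_type, Sum.elim_inl, Sum.elim_inr]
    rw [hsum, Finset.sum_add_distrib]
    ring

/-- Quantitative bound on the number of inputs without a solution. -/
theorem card_not_hasSolution_le (d : ℕ) (hd : 1 < d) (n n₁ k m M r w K : ℕ) (τ : ℤ)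
    (hn : n = n₁ + (2 * k + m)) (hn₁ : 0 < n₁) (hr : n₁ ≤ r ^ 2) (hM : 2 ≤ M)
    (hMC : M ≤ (2 * d) ^ n₁) (hK : 2 ≤ K) (hw : 0 < w) (hm : 0 < m)
    (hτ : 8 * (τ.natAbs + (2 * d * r + 1) * M + k * M) ≤ m * M)
    [DecidablePred fun x : Fin n → Fin M => HasSolution (coeffSet d) τ fun i => (x i : ℤ)] :
    ((Finset.univ.filter fun x : Fin n → Fin M =>
      ¬ HasSolution (coeffSet d) τ fun i => (x i : ℤ)).card : ℝ)
    ≤ (M : ℝ) ^ n * (1 / w + 64 / m + 1 / K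
      + 2 * (1 - 1 / (2 * (8 * w * (2 * (2 * d * r) * K + 1) : ℕ))) ^ k) := by
  classical
  set Γ := 8 * w * (2 * (2 * d * r) * K + 1) with hΓ
  have hΓ0 : 0 < Γ := by positivity
  -- Rounding up gives `M ≤ K * L`, while `L - 1 ≤ M / K` makes the too-far-left event cost only `1
  -- / K`.
  set L := M / K + 1 with hL
  set D := τ.natAbs + (2 * d * r + 1) * M + k * M with hD
  have hMr : (0 : ℝ) < M := by exact_mod_cast (by omega : 0 < M)
  have hLM : L ≤ M := by
    have : M / K ≤ M / 2 := Nat.div_le_div_left hK (by norm_num)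
    omega
  have hKL : M ≤ K * L := by
    have := Nat.lt_mul_div_succ M (by omega : 0 < K)
    exact this.le
  have hC : ∀ c ∈ coeffSet d, |c| ≤ d := fun c hc => (mem_coeffSet.1 hc).2
  have hne : (coeffSet d).Nonempty := by
    rw [← Finset.card_pos, card_coeffSet]; omega
  have hsmall : ∀ c : ℤ, c ≠ 0 → |c| ≤ 2 → c ∈ coeffSet d := fun c h0 h2 =>
    mem_coeffSet.2 ⟨h0, by have : (2 : ℤ) ≤ d := by exact_mod_cast hd
                           linarith⟩
  set good : (Fin n₁ → Fin M) → Prop := fun x =>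
    ∃ (a : ℤ) (G : Finset ℤ), |a| ≤ ((2 * d * r + 1) * M : ℕ) ∧
      (∀ g ∈ G, a ≤ g ∧ g < a + L ∧ ∃ c : Fin n₁ → ℤ, (∀ i, c i ∈ coeffSet d) ∧ ∑ i, (x i : ℤ) * c i = g) ∧
      M ≤ Γ * G.card with hgood
  have hbadx := card_not_dense_window_le (coeffSet d) d (by omega) hC (sum_coeffSet d) hne n₁ M r w K L hn₁ hr
    (by omega) (by rw [card_coeffSet]; exact hMC) (Nat.succ_pos _) hLM hKL good
    (fun x hx => hx)
  have hbady := card_small_sum_le M m D hM hτ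
  set sol : (Fin n₁ → Fin M) → (Fin k → Fin M × Fin M) → (Fin m → Fin M) → Prop := fun x z y =>
    ∃ (c : Fin n₁ → ℤ) (b b' : Fin k → ℤ) (e : Fin m → ℤ), (∀ i, c i ∈ coeffSet d) ∧ (∀ i, b i ∈ coeffSet d) ∧
      (∀ i, b' i ∈ coeffSet d) ∧ (∀ i, e i ∈ coeffSet d) ∧ ∑ i, (x i : ℤ) * c i
        = τ - ∑ i, (((z i).1 : ℤ) * b i + ((z i).2 : ℤ) * b' i) - ∑ i, (y i : ℤ) * e i with hsol
  have hrest : ∀ x, good x →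
      ((Finset.univ.filter fun q : (Fin k → Fin M × Fin M) × (Fin m → Fin M) =>
        (D : ℤ) ≤ ∑ i, (q.2 i : ℤ) ∧ ¬ sol x q.1 q.2).card : ℝ)
      ≤ (M : ℝ) ^ (2 * k + m) * (1 / K + 2 * (1 - 1 / (2 * (Γ : ℝ))) ^ k) := by
    rintro x ⟨a, G, ha, hG, hMG⟩
    have h := card_not_reach_le M k m L Γ D a τ G (by omega) hm
      (fun g hg => ⟨(hG g hg).1, (hG g hg).2.1⟩) hMG hΓ0 (by
        rw [hD]; push_cast at ha ⊢; linarith) (sol x) (by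
        rintro z y ⟨b, b', e, hb, hb', he, hg⟩
        obtain ⟨-, -, c, hc, hcg⟩ := hG _ hg
        refine ⟨c, b, b', e, hc, fun i => ?_, fun i => ?_, fun i => ?_, hcg⟩
        · rcases hb i with h | h <;> rw [h] <;> exact hsmall _ (by norm_num) (by norm_num)
        · rcases hb' i with h | h <;> rw [h] <;> exact hsmall _ (by norm_num) (by norm_num)
        · rcases he i with h | h <;> rw [h] <;> exact hsmall _ (by norm_num) (by norm_num))
    have hL1 : ((L - 1 : ℕ) : ℝ) ≤ M * (1 / K) := by
      rw [hL, Nat.add_sub_cancel, mul_one_div]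
      exact Nat.cast_div_le
    refine le_of_mul_le_mul_right (h.trans ?_) hMr
    rw [mul_assoc ((M : ℝ) ^ (2 * k + m))]
    refine mul_le_mul_of_nonneg_left ?_ (by positivity)
    linarith
  set bad : Finset ((Fin n₁ → Fin M) × ((Fin k → Fin M × Fin M) × (Fin m → Fin M))) :=
    Finset.univ.filter fun q => ¬ sol q.1 q.2.1 q.2.2 with hbad
  obtain ⟨σ⟩ : Nonempty (Fin n₁ ⊕ ((Fin k ⊕ Fin k) ⊕ Fin m) ≃ Fin n) :=
    Fintype.card_eq.1 (by simp; omega)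
  have hcard : (Finset.univ.filter fun x : Fin n → Fin M =>
      ¬ HasSolution (coeffSet d) τ fun i => (x i : ℤ)).card ≤ bad.card := by
    apply Finset.card_le_card_of_injOn (fun x => (fun i => x (σ (.inl i)),
      (fun i => (x (σ (.inr (.inl (.inl i)))), x (σ (.inr (.inl (.inr i)))))),
      fun i => x (σ (.inr (.inr i)))))
    · intro x hx
      simp only [Finset.coe_filter, Finset.mem_univ, true_and, Set.mem_ofPred_eq, hbad] at hx ⊢
      exact fun h => hx (hasSolution_of_blocks (coeffSet d) τ σ x h)
    · intro x _ y _ hxy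
      simp only [Prod.mk.injEq, funext_iff] at hxy
      obtain ⟨h1, h2, h3⟩ := hxy
      funext j
      obtain ⟨i, rfl⟩ := σ.surjective j
      rcases i with i | (i | i) | i
      · exact h1 i
      · exact (h2 i).1
      · exact (h2 i).2
      · exact h3 i
  -- Three ways to fail: no dense window, greedy coordinates with too small a sum, or a missed
  -- window despite both.
  set B₁ : Finset ((Fin n₁ → Fin M) × ((Fin k → Fin M × Fin M) × (Fin m → Fin M))) :=
    (Finset.univ.filter fun x => ¬ good x) ×ˢ Finset.univ with hB₁
  set B₂ : Finset ((Fin n₁ → Fin M) × ((Fin k → Fin M × Fin M) × (Fin m → Fin M))) :=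
    Finset.univ ×ˢ (Finset.univ ×ˢ
    Finset.univ.filter fun y : Fin m → Fin M => ¬ (D : ℤ) ≤ ∑ i, (y i : ℤ)) with hB₂
  set B₃ : Finset ((Fin n₁ → Fin M) × ((Fin k → Fin M × Fin M) × (Fin m → Fin M))) :=
    Finset.univ.filter fun q => good q.1 ∧
    ((D : ℤ) ≤ ∑ i, (q.2.2 i : ℤ) ∧ ¬ sol q.1 q.2.1 q.2.2) with hB₃
  have hsub : bad ⊆ B₁ ∪ B₂ ∪ B₃ := by
    intro q hq
    have hq' := (Finset.mem_filter.1 hq).2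
    simp only [hB₁, hB₂, hB₃, Finset.mem_union, Finset.mem_product, Finset.mem_filter,
      Finset.mem_univ, true_and, and_true]
    tauto
  have hc₁ : (B₁.card : ℝ) ≤ (M : ℝ) ^ n * (1 / w) := by
    have e : B₁.card = (Finset.univ.filter fun x => ¬ good x).card * M ^ (2 * k + m) := by
      rw [hB₁, Finset.card_product]
      simp [pow_add, pow_mul, sq]
    have h : ((Finset.univ.filter fun x => ¬ good x).card : ℝ) * w ≤ (M : ℝ) ^ n₁ := by
      exact_mod_cast hbadx
    have hw' : (0 : ℝ) < w := by exact_mod_cast hw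
    rw [e, hn, pow_add _ n₁]
    push_cast
    rw [mul_one_div, le_div_iff₀ hw', mul_right_comm]
    exact mul_le_mul_of_nonneg_right h (by positivity)
  have hc₂ : (B₂.card : ℝ) ≤ (M : ℝ) ^ n * (64 / m) := by
    have e : B₂.card = M ^ (n₁ + 2 * k) * (Finset.univ.filter fun y : Fin m → Fin M =>
        ¬ (D : ℤ) ≤ ∑ i, (y i : ℤ)).card := by
      rw [hB₂, Finset.card_product, Finset.card_product]
      simp [pow_add, pow_mul, sq, mul_assoc]
    have h : ((Finset.univ.filter fun y : Fin m → Fin M =>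
        ¬ (D : ℤ) ≤ ∑ i, (y i : ℤ)).card : ℝ) * m ≤ 64 * (M : ℝ) ^ m := by
      exact_mod_cast hbady
    have hm' : (0 : ℝ) < m := by exact_mod_cast hm
    rw [e, hn, ← add_assoc, pow_add _ (n₁ + 2 * k)]
    push_cast
    rw [mul_assoc]
    refine mul_le_mul_of_nonneg_left ?_ (by positivity)
    rw [← mul_div_assoc, le_div_iff₀ hm']
    linarith
  have hρ : (0 : ℝ) ≤ 1 - 1 / (2 * (Γ : ℝ)) := by
    have : (1 : ℝ) ≤ Γ := by exact_mod_cast hΓ0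
    rw [sub_nonneg, div_le_one (by positivity)]; linarith
  have hc₃ : (B₃.card : ℝ) ≤ (M : ℝ) ^ n * (1 / K + 2 * (1 - 1 / (2 * (Γ : ℝ))) ^ k) := by
    have e : B₃.card = ∑ x : Fin n₁ → Fin M,
        (Finset.univ.filter fun q : (Fin k → Fin M × Fin M) × (Fin m → Fin M) =>
          good x ∧ ((D : ℤ) ≤ ∑ i, (q.2 i : ℤ) ∧ ¬ sol x q.1 q.2)).card := by
      simp only [hB₃, Finset.card_filter]
      exact Fintype.sum_prod_type _
    rw [e]
    push_cast
    refine (Finset.sum_le_card_nsmul _ _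
      ((M : ℝ) ^ (2 * k + m) * (1 / K + 2 * (1 - 1 / (2 * (Γ : ℝ))) ^ k)) fun x _ => ?_).trans ?_
    · by_cases hx : good x
      · simpa [hx] using hrest x hx
      · simp only [hx, false_and, Finset.filter_false, Finset.card_empty, Nat.cast_zero]
        positivity
    · rw [hn, pow_add _ n₁]
      simp [mul_assoc]
  have hfin : ((Finset.univ.filter fun x : Fin n → Fin M =>
      ¬ HasSolution (coeffSet d) τ fun i => (x i : ℤ)).card : ℝ) ≤ B₁.card + B₂.card + B₃.card := by
    exact_mod_cast hcard.trans ((Finset.card_le_card hsub).trans ((Finset.card_union_le _ _).trans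
      (Nat.add_le_add_right (Finset.card_union_le _ _) _)))
  linarith

/-! ### Upper bounds on the probability -/

theorem solutionProb_le_one (C : Finset ℤ) (n M : ℕ) (τ : ℤ) (hM : 0 < M) :
    solutionProb C n M τ ≤ 1 := by
  classical
  rw [solutionProb_eq, div_le_one (by positivity)]
  have := Finset.card_le_univ
    (Finset.univ.filter fun x : Fin n → Fin M => HasSolution C τ fun i => (x i : ℤ))
  simp only [Fintype.card_pi, Fintype.card_fin, Finset.prod_const, Finset.card_univ] at this
  exact_mod_cast this

/-- The union bound over all coefficient vectors. -/
theorem solutionProb_le (C : Finset ℤ) (h0 : (0 : ℤ) ∉ C) (n M : ℕ) (τ : ℤ) (hn : 0 < n)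
    (hM : 0 < M) : solutionProb C n M τ ≤ (C.card : ℝ) ^ n / M := by
  classical
  rw [solutionProb_eq, div_le_div_iff₀ (by positivity) (by positivity)]
  set P := Fintype.piFinset fun _ : Fin n => C with hP
  have hPc : P.card = C.card ^ n := by simp [hP]
  have hsub : (Finset.univ.filter fun x : Fin n → Fin M => HasSolution C τ fun i => (x i : ℤ))
      ⊆ P.biUnion fun c => Finset.univ.filter fun x : Fin n → Fin M =>
        ∑ i, (x i : ℤ) * c i = τ := by
    intro x hx
    obtain ⟨c, hc, hxc⟩ := (Finset.mem_filter.1 hx).2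
    simp only [Finset.mem_biUnion, Finset.mem_filter, Finset.mem_univ, true_and]
    exact ⟨c, Fintype.mem_piFinset.2 hc, hxc⟩
  have h := Nat.mul_le_mul_right M ((Finset.card_le_card hsub).trans Finset.card_biUnion_le)
  rw [Finset.sum_mul] at h
  have h2 := h.trans (Finset.sum_le_card_nsmul P _ (M ^ n) fun c hc => by
    have := card_linear_eq_mul_le M c ⟨0, hn⟩
      (fun h => h0 (h ▸ Fintype.mem_piFinset.1 hc ⟨0, hn⟩)) τ
    simpa using this)
  rw [smul_eq_mul, hPc] at h2
  exact_mod_cast h2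

/-! ### Choice of parameters and the limit -/

theorem eventually_mul_sqrt_le (R : ℝ) : ∀ᶠ n : ℕ in Filter.atTop,
    R * ((n.sqrt + 1 : ℕ) : ℝ) ≤ n := by
  obtain ⟨Q, hQ⟩ := exists_nat_ge R
  filter_upwards [Filter.eventually_ge_atTop ((2 * Q + 1) ^ 2)] with n hn
  have h1 : 2 * Q + 1 ≤ n.sqrt := by rw [Nat.le_sqrt']; exact hn
  have h2 : n.sqrt ^ 2 ≤ n := Nat.sqrt_le' n
  have h3 : Q * (n.sqrt + 1) ≤ n := by nlinarith
  calc R * ((n.sqrt + 1 : ℕ) : ℝ) ≤ Q * ((n.sqrt + 1 : ℕ) : ℝ) := by gcongr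
    _ ≤ n := by exact_mod_cast h3

/-- Bernoulli applied to `(1 + t) ^ k`, together with `(1 - t) (1 + t) ≤ 1`. This weak decay
suffices because `k * t` tends to infinity in the application. -/
theorem one_sub_pow_le_inv {t : ℝ} (ht1 : t ≤ 1) (ht0 : 0 ≤ t) (k : ℕ) :
    (1 - t) ^ k ≤ 1 / (1 + k * t) := by
  have h1 : (1 - t) * (1 + t) ≤ 1 := by nlinarith [sq_nonneg t]
  have h2 := one_add_mul_le_pow (by linarith : (-2 : ℝ) ≤ t) k
  have h3 : (1 - t) ^ k * (1 + t) ^ k ≤ 1 := by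
    rw [← mul_pow]; exact pow_le_one₀ (by nlinarith) h1
  rw [le_div_iff₀ (by positivity)]
  exact (mul_le_mul_of_nonneg_left h2 (pow_nonneg (by linarith) k)).trans h3

/-- Below the threshold, a solution exists with probability tending to `1`, uniformly. -/
theorem eventually_le_solutionProb (d : ℕ) (hd : 1 < d) (ε : ℝ) (hε : 0 < ε)
    (h : ℕ → ℝ) (hh : Filter.Tendsto h Filter.atTop (nhds 0)) (δ : ℝ) (hδ : 0 < δ) :
    ∀ᶠ n : ℕ in Filter.atTop, ∀ (M : ℕ) (τ : ℤ), 2 ≤ M →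
      |(τ : ℝ)| ≤ h n * ((M : ℝ) * (n : ℝ)) →
      (M : ℝ) ≤ ((coeffSet d).card : ℝ) ^ ((1 - ε) * (n : ℝ)) →
        1 - δ ≤ solutionProb (coeffSet d) n M τ := by
  classical
  obtain ⟨w₀, hw₀⟩ := exists_nat_ge (4 / δ)
  set w := w₀ + 2 with hw
  have hwδ : 1 / (w : ℝ) ≤ δ / 4 := by
    rw [div_le_iff₀ (by positivity)]
    rw [div_le_iff₀ hδ] at hw₀
    rw [hw]; push_cast; nlinarith
  -- Each of the `k ≈ θ n` units uses `18 = 2 + 16` coordinates: one pair and 16 greedy ones. The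
  -- minimum keeps `n₁ ≥ (1 - ε) n` and `n₁ > 0`.
  set θ : ℝ := min ε (1 / 2) / 18 with hθ
  have hθ0 : 0 < θ := by positivity
  have hθε : 18 * θ ≤ ε := by rw [hθ]; linarith [min_le_left ε (1 / 2)]
  have hθ2 : 18 * θ ≤ 1 / 2 := by rw [hθ]; linarith [min_le_right ε (1 / 2)]
  set c : ℝ := 8 * w * (4 * d * w + 1) with hc
  have hc0 : 0 < c := by positivity
  -- In order, these ensure `k ≥ θ n / 2`, room for the window's `O(√n M)` offset, `k * δ ≥ 16`, `k
  -- * δ ≥ 16 * Γ`, and a small enough target.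
  filter_upwards [eventually_mul_sqrt_le (2 / θ), eventually_mul_sqrt_le (4 * (2 * d + 1) / θ),
    eventually_mul_sqrt_le (32 / (δ * θ)), eventually_mul_sqrt_le (32 * c / (δ * θ)),
    hh.eventually_le_const (by positivity : (0 : ℝ) < θ / 4)] with n ha hb hcc hdd hhn M τ hM hτ hMC
  set r := n.sqrt + 1 with hr
  have hr1 : (1 : ℝ) ≤ r := by rw [hr]; push_cast; linarith [Nat.cast_nonneg (α := ℝ) n.sqrt]
  have hMr : (0 : ℝ) < M := by exact_mod_cast (by omega : 0 < M)
  rw [div_mul_eq_mul_div, div_le_iff₀ (by positivity)] at ha hb hcc hdd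
  set k := ⌊θ * n⌋₊ with hk
  have hk1 : (k : ℝ) ≤ θ * n := Nat.floor_le (by positivity)
  have hk2 : θ * n < k + 1 := Nat.lt_floor_add_one _
  have hk3 : θ * n / 2 ≤ k := by linarith
  have hkδ : 16 ≤ k * δ := by linarith [mul_le_mul_of_nonneg_right hk3 hδ.le]
  have hkpos : (0 : ℝ) < k := by
    by_contra! hk0
    linarith
  have hk0 : 0 < k := by exact_mod_cast hkpos
  have hn0 : (0 : ℝ) < n := by
    by_contra! hn0
    linarith [mul_nonpos_of_nonneg_of_nonpos hθ0.le hn0]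
  have h18 : 18 * k ≤ n := by
    have : (18 : ℝ) * k ≤ n := by linarith [mul_le_mul_of_nonneg_right hθ2 hn0.le]
    exact_mod_cast this
  set n₁ := n - 18 * k with hn₁
  have hn₁r : (n₁ : ℝ) = n - 18 * k := by rw [hn₁]; push_cast [h18]; ring
  have hn₁pos : 0 < n₁ := by
    have : (0 : ℝ) < n₁ := by rw [hn₁r]; linarith [mul_le_mul_of_nonneg_right hθ2 hn0.le]
    exact_mod_cast this
  have hMn₁ : M ≤ (2 * d) ^ n₁ := by
    have h1 : (1 : ℝ) ≤ ((coeffSet d).card : ℝ) := by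
      rw [card_coeffSet]; exact_mod_cast (by omega : 1 ≤ 2 * d)
    have h2 := hMC.trans (Real.rpow_le_rpow_of_exponent_le h1
      (by rw [hn₁r]; linarith [mul_le_mul_of_nonneg_right hθε hn0.le] : (1 - ε) * (n : ℝ) ≤ (n₁ : ℝ)))
    rw [Real.rpow_natCast, card_coeffSet] at h2
    exact_mod_cast h2
  -- Target and offset each cost at most `θ n M / 4`, together at most `k * M`; the pairs cost
  -- another `k * M`. Hence `m = 16 * k`.
  have hτ' : 8 * (τ.natAbs + (2 * d * r + 1) * M + k * M) ≤ 16 * k * M := by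
    have hτr : (τ.natAbs : ℝ) = |(τ : ℝ)| := by
      rw [Nat.cast_natAbs, Int.cast_abs]
    have h1 : (τ.natAbs : ℝ) ≤ θ / 4 * n * M := by
      rw [hτr]
      refine hτ.trans ?_
      linarith [mul_le_mul_of_nonneg_right hhn (by positivity : (0 : ℝ) ≤ M * n)]
    have h2 : (2 * d * r + 1 : ℝ) ≤ θ / 4 * n := by linarith
    have h3 := mul_le_mul_of_nonneg_right h2 hMr.le
    have h4 := mul_le_mul_of_nonneg_right hk3 hMr.le
    have h5 : (8 : ℝ) * (τ.natAbs + (2 * d * r + 1) * M + k * M) ≤ 16 * k * M := by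
      linarith
    exact_mod_cast h5
  have hmain := card_not_hasSolution_le d hd n n₁ k (16 * k) M r w w τ (by omega) hn₁pos
    ((by omega : n₁ ≤ n).trans (by rw [sq]; exact (Nat.lt_succ_sqrt n).le)) hM hMn₁ (by omega)
    (by omega) (by omega) hτ'
  set Γ := 8 * w * (2 * (2 * d * r) * w + 1) with hΓ
  have hΓ1 : (1 : ℝ) ≤ Γ := by
    exact_mod_cast (by rw [hΓ, hw]; exact Nat.succ_le_of_lt (by positivity) : 1 ≤ Γ)
  have hΓc : (Γ : ℝ) ≤ c * r := by
    rw [hΓ, hc]; push_cast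
    linarith [mul_le_mul_of_nonneg_left hr1 (by positivity : (0 : ℝ) ≤ w)]
  have hpow := one_sub_pow_le_inv (t := 1 / (2 * (Γ : ℝ)))
    (by rw [div_le_one (by positivity)]; linarith) (by positivity) k
  have hpow2 : 1 / (1 + k * (1 / (2 * (Γ : ℝ)))) ≤ δ / 8 := by
    rw [div_le_iff₀ (by positivity)]
    have : 8 / δ ≤ k * (1 / (2 * (Γ : ℝ))) := by
      rw [mul_one_div, div_le_div_iff₀ hδ (by positivity)]
      linarith [mul_le_mul_of_nonneg_right hk3 hδ.le]
    rw [div_le_iff₀ hδ] at this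
    linarith
  have h64 : 64 / ((16 * k : ℕ) : ℝ) ≤ δ / 4 := by
    rw [div_le_iff₀ (by push_cast; positivity)]
    push_cast; linarith
  have hsplit := Finset.card_filter_add_card_filter_not (s := (Finset.univ : Finset (Fin n → Fin M)))
    (fun x => HasSolution (coeffSet d) τ fun i => (x i : ℤ))
  simp only [Finset.card_univ, Fintype.card_pi, Fintype.card_fin, Finset.prod_const] at hsplit
  have hsplit' : ((Finset.univ.filter fun x : Fin n → Fin M =>
      HasSolution (coeffSet d) τ fun i => (x i : ℤ)).card : ℝ)
      + ((Finset.univ.filter fun x : Fin n → Fin M =>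
      ¬ HasSolution (coeffSet d) τ fun i => (x i : ℤ)).card : ℝ) = (M : ℝ) ^ n := by
    exact_mod_cast hsplit
  have hMn : (0 : ℝ) < (M : ℝ) ^ n := by positivity
  -- Each of the four error terms is at most `δ / 4`.
  have hbound := hmain.trans (mul_le_mul_of_nonneg_left
    (by linarith : _ ≤ δ) hMn.le)
  rw [solutionProb_eq, le_div_iff₀ hMn]
  linarith

theorem mainTheorem4 (d : ℕ) (hd : 1 < d) (ε : ℝ) (hε : 0 < ε)
    (h : ℕ → ℝ) (hh : Filter.Tendsto h Filter.atTop (nhds 0)) :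
    ∃ err : ℕ → ℝ, Filter.Tendsto err Filter.atTop (nhds 0) ∧
      ∀ (n M : ℕ) (τ : ℤ), 1 ≤ n → 2 ≤ M → |(τ : ℝ)| ≤ h n * ((M : ℝ) * (n : ℝ)) →
        ((M : ℝ) ≤ ((coeffSet d).card : ℝ) ^ ((1 - ε) * (n : ℝ)) →
          1 - err n ≤ solutionProb (coeffSet d) n M τ) ∧
        (((coeffSet d).card : ℝ) ^ n ≤ (M : ℝ) →
          solutionProb (coeffSet d) n M τ ≤ ((coeffSet d).card : ℝ) ^ n / (M : ℝ)) := by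
  -- The error is the worst failure probability over all admissible `M` and `τ`, which makes it
  -- uniform in both.
  set S : ℕ → Set ℝ := fun n => {e | ∃ (M : ℕ) (τ : ℤ), 2 ≤ M ∧
    |(τ : ℝ)| ≤ h n * ((M : ℝ) * (n : ℝ)) ∧
    (M : ℝ) ≤ ((coeffSet d).card : ℝ) ^ ((1 - ε) * (n : ℝ)) ∧
    e = 1 - solutionProb (coeffSet d) n M τ} with hS
  have hbdd : ∀ n, BddAbove (S n) := fun n => ⟨1, by
    rintro e ⟨M, τ, -, -, -, rfl⟩
    have : 0 ≤ solutionProb (coeffSet d) n M τ := MeasureTheory.measureReal_nonneg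
    linarith⟩
  refine ⟨fun n => sSup (S n), ?_, fun n M τ hn hM hτ => ⟨fun hMC => ?_, fun _ => ?_⟩⟩
  · rw [Metric.tendsto_atTop']
    intro δ hδ
    obtain ⟨N, hN⟩ := Filter.eventually_atTop.1
      (eventually_le_solutionProb d hd ε hε h hh (δ / 2) (by positivity))
    refine ⟨N, fun n hn => ?_⟩
    -- If no `M`, `τ` are admissible, `sSup ∅ = 0` is consistent with both bounds.
    have h0 : 0 ≤ sSup (S n) := Real.sSup_nonneg (by
      rintro e ⟨M, τ, hM, -, -, rfl⟩
      linarith [solutionProb_le_one (coeffSet d) n M τ (by omega)])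
    have h1 : sSup (S n) ≤ δ / 2 := Real.sSup_le (by
      rintro e ⟨M, τ, hM, hτ, hMC, rfl⟩
      linarith [hN n hn.le M τ hM hτ hMC]) (by positivity)
    rw [Real.dist_eq, sub_zero, abs_of_nonneg h0]
    linarith
  · have := le_csSup (hbdd n) ⟨M, τ, hM, hτ, hMC, rfl⟩
    linarith
  · exact solutionProb_le _ (by simp [mem_coeffSet]) n M τ (by omega) (by omega)
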